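/- Let $H$ be the two-mode Fock space, a complex Hilbert space with orthonormal basis $\{|km\rangle : k,m=0,1,2,\dots\}$, and let $\hat a_R,\hat a_R^\dagger,\hat a_I,\hat a_I^\dagger$ be the annihilation and creation operators of the two modes, defined on finite linear combinations of basis vectors by $$\hat a_R|km\rangle=\sqrt{k}\,|k-1,m\rangle,\quad \hat a_R^\dagger|km\rangle=\sqrt{k+1}\,|k+1,m\rangle,\quad \hat a_I|km\rangle=\sqrt{m}\,|k,m-1\rangle,\quad \hat a_I^\dagger|km\rangle=\sqrt{m+1}\,|k,m+1\rangle .$$ For $\omega\in\mathbb{C}$ let $\hat S(\omega)=\exp(\omega^\ast\hat a_R\hat a_I-\omega\,\hat a_R^\dagger\hat a_I^\dagger)$ be the two-mode squeezing operator, that is, $\hat S(\omega)=U(1)$, where $(U(r))_{r\in\mathbb{R}}$ is a strongly continuous one-parameter unitary group on $H$ with $\frac{d}{dr}U(r)\psi\big|_{r=0}=(\omega^\ast\hat a_R\hat a_I-\omega\,\hat a_R^\dagger\hat a_I^\dagger)\psi$ for every finite linear combination $\psi$ of basis vectors. Then for every $\omega\in\mathbb{C}$ the operator $\hat S(\omega)$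 exists and is uniquely determined, and for all integers $s,t,k,m\ge 0$ $$\langle st|\hat S(\omega)|km\rangle=(-\tau)^{s-k}\sqrt{s!\,t!\,k!\,m!}\;\delta(s-k,t-m)\sum_{u=\max(k-s,0)}^{\min(k,m)}\frac{(-|\tau|^2)^u\,\nu^{-k-m+2u-1}}{(s-k+u)!\,u!\,(k-u)!\,(m-u)!},$$ where $\tau=\frac{\omega}{|\omega|}\tanh|\omega|$, $\nu=\cosh|\omega|$, and $\delta(x,y)$ is $1$ if $x=y$ and $0$ otherwise; in particular the matrix element vanishes unless $s-k=t-m$. For $\omega=0$ the formula is read with $\tau=0$, $0^0=1$ and $0^j=0$ for every integer $j\neq 0$. -/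

import Mathlib

noncomputable section

/-- Finite linear combinations of the two-mode Fock states: `Finsupp.single (k, m) 1` stands for the
state `|k m⟩` with `k` photons in mode `R` and `m` photons in mode `I`. -/
abbrev FiniteFock : Type := (ℕ × ℕ) →₀ ℂ

namespace FiniteFock

/-- Annihilation operator of mode `R`: `|k m⟩ ↦ √k |k-1, m⟩` (which is `0` for `k = 0`). -/
def annR : FiniteFock →ₗ[ℂ] FiniteFock :=
  Finsupp.linearCombination ℂ fun p : ℕ × ℕ =>
    Finsupp.single (p.1 - 1, p.2) ((Real.sqrt (p.1 : ℝ) : ℝ) : ℂ)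

/-- Annihilation operator of mode `I`: `|k m⟩ ↦ √m |k, m-1⟩` (which is `0` for `m = 0`). -/
def annI : FiniteFock →ₗ[ℂ] FiniteFock :=
  Finsupp.linearCombination ℂ fun p : ℕ × ℕ =>
    Finsupp.single (p.1, p.2 - 1) ((Real.sqrt (p.2 : ℝ) : ℝ) : ℂ)

/-- Creation operator of mode `R`: `|k m⟩ ↦ √(k+1) |k+1, m⟩`. -/
def creR : FiniteFock →ₗ[ℂ] FiniteFock :=
  Finsupp.linearCombination ℂ fun p : ℕ × ℕ =>
    Finsupp.single (p.1 + 1, p.2) ((Real.sqrt ((p.1 : ℝ) + 1) : ℝ) : ℂ)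

/-- Creation operator of mode `I`: `|k m⟩ ↦ √(m+1) |k, m+1⟩`. -/
def creI : FiniteFock →ₗ[ℂ] FiniteFock :=
  Finsupp.linearCombination ℂ fun p : ℕ × ℕ =>
    Finsupp.single (p.1, p.2 + 1) ((Real.sqrt ((p.2 : ℝ) + 1) : ℝ) : ℂ)

/-- The exponent `ω* a_R a_I - ω a_R† a_I†` of the two-mode squeezing operator. -/
def squeezeExponent (ω : ℂ) : FiniteFock →ₗ[ℂ] FiniteFock :=
  (starRingEnd ℂ) ω • (annR ∘ₗ annI) - ω • (creR ∘ₗ creI)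

/-- The finite Fock vectors inside a Hilbert space with orthonormal basis `b (k, m) = |k m⟩`. -/
def toHilbert {H : Type*} [NormedAddCommGroup H] [InnerProductSpace ℂ H]
    (b : HilbertBasis (ℕ × ℕ) ℂ H) : FiniteFock →ₗ[ℂ] H :=
  Finsupp.linearCombination ℂ (b : ℕ × ℕ → H)

end FiniteFock

/-- A strongly continuous one-parameter group of unitary operators. -/
structure IsUnitaryGroup {H : Type*} [NormedAddCommGroup H] [InnerProductSpace ℂ H]
    (U : ℝ → (H ≃ₗᵢ[ℂ] H)) : Prop where
  map_add : ∀ (r r' : ℝ) (x : H), U (r + r') x = U r (U r' x)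
  continuous : ∀ x : H, Continuous fun r : ℝ => U r x

/-- `S = exp A` for a (in general unbounded) operator `A` given on the dense subspace of finite Fock
vectors: `S` is the value at time `1` of a strongly continuous one-parameter unitary group whose
infinitesimal generator extends `A`. -/
def IsUnitaryExp {H : Type*} [NormedAddCommGroup H] [InnerProductSpace ℂ H]
    (b : HilbertBasis (ℕ × ℕ) ℂ H) (A : FiniteFock →ₗ[ℂ] FiniteFock) (S : H ≃ₗᵢ[ℂ] H) : Prop :=
  ∃ U : ℝ → (H ≃ₗᵢ[ℂ] H), IsUnitaryGroup U ∧
    (∀ ψ : FiniteFock, HasDerivAt (fun r : ℝ => U r (FiniteFock.toHilbert b ψ))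
      (FiniteFock.toHilbert b (A ψ)) 0) ∧
    U 1 = S

/-- `S` is the two-mode squeezing operator `S(ω) = exp(ω* a_R a_I - ω a_R† a_I†)`. -/
def IsTwoModeSqueezer {H : Type*} [NormedAddCommGroup H] [InnerProductSpace ℂ H]
    (b : HilbertBasis (ℕ × ℕ) ℂ H) (ω : ℂ) (S : H ≃ₗᵢ[ℂ] H) : Prop :=
  IsUnitaryExp b (FiniteFock.squeezeExponent ω) S

/-- `τ = (ω / |ω|) tanh |ω|`; for `ω = 0` this is `0`, the limit as `ω → 0`. -/
def squeezeTau (ω : ℂ) : ℂ := ω / ((‖ω‖ : ℝ) : ℂ) * ((Real.tanh ‖ω‖ : ℝ) : ℂ)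

/-- `ν = cosh |ω|`. -/
def squeezeNu (ω : ℂ) : ℝ := Real.cosh ‖ω‖

end

open Filter Topology ComplexConjugate

/-! ### Exponentials of bounded skew-adjoint operators -/

section BoundedGenerator

variable {H : Type*} [NormedAddCommGroup H] [InnerProductSpace ℂ H] [CompleteSpace H]

/-! Existence. Cut off at `N` photons per mode, the exponent becomes a bounded skew-adjoint
operator, which agrees with the true exponent `A` on any fixed finite vector once `N` is large.
Since its exponential is isometric, the Taylor remainder at order `n` is at most `|r|^n / n!` times
the norm of the `n`-th power on the vector. One application of `A` costs a factor linear in the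
photon number, so `‖A^j |k m⟩‖` grows like `j!` times a geometric factor: all finite vectors are
analytic with a common radius. The cut-off exponentials therefore converge for small `r`, and by the
group law for every `r` (`exists_isUnitaryGroup_hasDerivAt`).

Formula. For any such group, the elements `⟨s t| U(r) |k m⟩` solve an infinite linear system in `(k,
m)` whose coefficients grow only linearly, so at most one solution of exponential growth has given
initial values (`IsSqueezeEvolution.eq_zero`). The explicit expression is the one suggested by the
disentangling `exp(-τ a_R† a_I†) ν^(-(n_R + n_I + 1)) exp(τ* a_R a_I)`; it is checked directly to
solve the system (`hasDerivAt_squeezeSum`), to grow at most exponentially and to start at the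
identity. No operator factorisation is needed. Uniqueness of `S` follows, because its matrix
elements are forced. -/

lemma norm_exp_apply {T : H →L[ℂ] H} (hT : T ∈ skewAdjoint (H →L[ℂ] H)) (x : H) :
    ‖NormedSpace.exp T x‖ = ‖x‖ := by
  let +nondep : NormedAlgebra ℚ (H →L[ℂ] H) := .restrictScalars ℚ ℂ _
  have hu := NormedSpace.exp_mem_unitary_of_mem_skewAdjoint hT
  exact ContinuousLinearMap.norm_map_of_mem_unitary hu x

lemma norm_exp_smul_apply {T : H →L[ℂ] H} (hT : T ∈ skewAdjoint (H →L[ℂ] H)) (r : ℝ) (x : H) :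
    ‖NormedSpace.exp (r • T) x‖ = ‖x‖ :=
  norm_exp_apply (skewAdjoint.smul_mem r hT) x

lemma exp_add_smul_apply (T : H →L[ℂ] H) (r r' : ℝ) (x : H) :
    NormedSpace.exp ((r + r') • T) x = NormedSpace.exp (r • T) (NormedSpace.exp (r' • T) x) := by
  let +nondep : NormedAlgebra ℚ (H →L[ℂ] H) := .restrictScalars ℚ ℂ _
  rw [add_smul, NormedSpace.exp_add_of_commute]
  · rfl
  · exact ((Commute.refl T).smul_left r).smul_right r'

lemma hasDerivAt_exp_smul_apply (T : H →L[ℂ] H) (x : H) (r : ℝ) :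
    HasDerivAt (fun r : ℝ => NormedSpace.exp (r • T) x) (NormedSpace.exp (r • T) (T x)) r :=
  ((ContinuousLinearMap.apply ℂ H x).restrictScalars ℝ).hasFDerivAt.comp_hasDerivAt r
    (hasDerivAt_exp_smul_const T r)

/-- Taylor expansion of a unitary exponential, with remainder controlled by the next power only. -/
lemma norm_exp_smul_sub_sum_le {T : H →L[ℂ] H} (hT : T ∈ skewAdjoint (H →L[ℂ] H)) (n : ℕ)
    (x : H) {r : ℝ} (hr : 0 ≤ r) :
    ‖NormedSpace.exp (r • T) x - ∑ j ∈ Finset.range n, (r ^ j / j.factorial) • (T ^ j) x‖ ≤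
      r ^ n / n.factorial * ‖(T ^ n) x‖ := by
  induction n generalizing x r with
  | zero => simp [norm_exp_smul_apply hT]
  | succ n ih =>
    have hpow (j : ℕ) (t : ℝ) : HasDerivAt (fun t : ℝ => t ^ (j + 1) / (j + 1).factorial)
        (t ^ j / j.factorial) t := by
      refine ((hasDerivAt_pow (j + 1) t).div_const ((j + 1).factorial : ℝ)).congr_deriv ?_
      rw [Nat.factorial_succ]
      push_cast
      field_simp
    -- The derivative of the remainder for `x` at order `n + 1` is the remainder for `T x` at order
    -- `n`, to which the induction hypothesis applies.
    have hd (t : ℝ) : HasDerivAt (fun t : ℝ => NormedSpace.exp (t • T) x -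
        ∑ j ∈ Finset.range (n + 1), (t ^ j / j.factorial) • (T ^ j) x)
        (NormedSpace.exp (t • T) (T x) -
          ∑ j ∈ Finset.range n, (t ^ j / j.factorial) • (T ^ j) (T x)) t := by
      refine (hasDerivAt_exp_smul_apply T x t).sub ?_
      simp_rw [Finset.sum_range_succ']
      simp only [pow_zero]
      refine HasDerivAt.add_const _ ?_
      refine HasDerivAt.fun_sum fun j _ => ?_
      exact (hpow j t).smul_const ((T ^ j) (T x))
    refine image_norm_le_of_norm_deriv_right_le_deriv_boundary (a := 0) (b := r)
      (fun t _ => (hd t).continuousAt.continuousWithinAt)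
      (fun t _ => (hd t).hasDerivWithinAt)
      (B := fun t => t ^ (n + 1) / (n + 1).factorial * ‖(T ^ (n + 1)) x‖)
      (B' := fun t => t ^ n / n.factorial * ‖(T ^ (n + 1)) x‖) ?_ (fun t => (hpow n t).mul_const _)
      (fun t ht => ?_) ⟨hr, le_rfl⟩
    · simp [Finset.sum_range_succ']
    · simpa [pow_succ] using ih (T x) ht.1

end BoundedGenerator

/-! ### Unitary groups as strong limits of bounded exponentials -/

section UnitaryLimit

lemma eventually_pow_apply_eq {H : Type*} [NormedAddCommGroup H] [NormedSpace ℂ H]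
    {E : Type*} [AddCommGroup E] [Module ℂ E] {ι : E →ₗ[ℂ] H} {A : E →ₗ[ℂ] E} {T : ℕ → H →L[ℂ] H}
    (hTA : ∀ ψ, ∀ᶠ n in atTop, T n (ι ψ) = ι (A ψ)) (j : ℕ) (ψ : E) :
    ∀ᶠ n in atTop, (T n ^ j) (ι ψ) = ι ((A ^ j) ψ) := by
  induction j generalizing ψ with
  | zero => simp
  | succ j ih =>
    filter_upwards [hTA ψ, ih (A ψ)] with n h1 h2
    rw [pow_succ, pow_succ]
    change (T n ^ j) (T n (ι ψ)) = ι ((A ^ j) (A ψ))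
    rw [h1, h2]

variable {H : Type*} [NormedAddCommGroup H] [InnerProductSpace ℂ H] [CompleteSpace H]

lemma norm_exp_smul_sub_sum_le_abs {T : H →L[ℂ] H} (hT : T ∈ skewAdjoint (H →L[ℂ] H)) (n : ℕ)
    (x : H) (r : ℝ) :
    ‖NormedSpace.exp (r • T) x - ∑ j ∈ Finset.range n, (r ^ j / j.factorial) • (T ^ j) x‖ ≤
      |r| ^ n / n.factorial * ‖(T ^ n) x‖ := by
  rcases le_total 0 r with hr | hr
  · rw [abs_of_nonneg hr]
    exact norm_exp_smul_sub_sum_le hT n x hr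
  · have h := norm_exp_smul_sub_sum_le (neg_mem hT) n x (neg_nonneg.2 hr)
    have hnorm : ‖((-T) ^ n) x‖ = ‖(T ^ n) x‖ := by
      rcases Nat.even_or_odd n with hn | hn
      · rw [hn.neg_pow]
      · rw [hn.neg_pow, neg_apply, norm_neg]
    have hterm (j : ℕ) : ((-r) ^ j / (j.factorial : ℝ)) • ((-T) ^ j) x =
        (r ^ j / (j.factorial : ℝ)) • (T ^ j) x := by
      rcases Nat.even_or_odd j with hj | hj
      · rw [hj.neg_pow, hj.neg_pow]
      · rw [hj.neg_pow, hj.neg_pow, neg_apply, neg_div, neg_smul_neg]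
    rw [abs_of_nonpos hr, ← hnorm]
    simpa only [hterm, neg_smul_neg] using h

variable {E : Type*} [AddCommGroup E] [Module ℂ E] {ι : E →ₗ[ℂ] H} {A : E →ₗ[ℂ] E}
  {T : ℕ → H →L[ℂ] H}

/-- For large `n` all the exponentials share one Taylor polynomial, built from `A`, and their
remainders are bounded independently of `n`. -/
lemma cauchySeq_exp_apply_of_analytic (hT : ∀ n, T n ∈ skewAdjoint (H →L[ℂ] H))
    (hTA : ∀ ψ, ∀ᶠ n in atTop, T n (ι ψ) = ι (A ψ)) {r : ℝ} {ψ : E}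
    (hA : Tendsto (fun j : ℕ => |r| ^ j / j.factorial * ‖ι ((A ^ j) ψ)‖) atTop (𝓝 0)) :
    CauchySeq fun n => NormedSpace.exp (r • T n) (ι ψ) := by
  rw [Metric.cauchySeq_iff']
  intro ε hε
  obtain ⟨J, hJ⟩ := (hA.eventually (gt_mem_nhds (half_pos hε))).exists
  have hev : ∀ᶠ n in atTop, ∀ j ∈ Finset.range (J + 1), (T n ^ j) (ι ψ) = ι ((A ^ j) ψ) :=
    (eventually_all_finset _).2 fun j _ => eventually_pow_apply_eq hTA j ψ
  obtain ⟨N, hN⟩ := eventually_atTop.1 hev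
  have key (n : ℕ) (hn : N ≤ n) : dist (NormedSpace.exp (r • T n) (ι ψ))
      (∑ j ∈ Finset.range J, (r ^ j / j.factorial) • ι ((A ^ j) ψ)) < ε / 2 := by
    rw [dist_eq_norm]
    have h := norm_exp_smul_sub_sum_le_abs (hT n) J (ι ψ) r
    rw [hN n hn J (by simp), Finset.sum_congr rfl fun j hj =>
      by rw [hN n hn j (Finset.mem_range.2 ((Finset.mem_range.1 hj).trans J.lt_succ_self))]] at h
    exact h.trans_lt hJ
  refine ⟨N, fun n hn => ?_⟩
  have := dist_triangle_right (NormedSpace.exp (r • T n) (ι ψ)) (NormedSpace.exp (r • T N) (ι ψ))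
    (∑ j ∈ Finset.range J, (r ^ j / j.factorial) • ι ((A ^ j) ψ))
  linarith [key n hn, key N le_rfl]

lemma cauchySeq_exp_apply_of_denseRange (hT : ∀ n, T n ∈ skewAdjoint (H →L[ℂ] H))
    (hι : DenseRange ι) {r : ℝ}
    (h : ∀ ψ, CauchySeq fun n => NormedSpace.exp (r • T n) (ι ψ)) (x : H) :
    CauchySeq fun n => NormedSpace.exp (r • T n) x := by
  rw [Metric.cauchySeq_iff']
  intro ε hε
  obtain ⟨ψ, hψ⟩ := hι.exists_dist_lt x (by positivity : 0 < ε / 3)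
  obtain ⟨N, hN⟩ := Metric.cauchySeq_iff'.1 (h ψ) (ε / 3) (by positivity)
  have key (n : ℕ) : dist (NormedSpace.exp (r • T n) x) (NormedSpace.exp (r • T n) (ι ψ)) < ε / 3 := by
    rw [dist_eq_norm, ← map_sub, norm_exp_smul_apply (hT n), ← dist_eq_norm]
    exact hψ
  refine ⟨N, fun n hn => ?_⟩
  have h1 := dist_triangle4_right (NormedSpace.exp (r • T n) x) (NormedSpace.exp (r • T N) x)
    (NormedSpace.exp (r • T n) (ι ψ)) (NormedSpace.exp (r • T N) (ι ψ))
  linarith [key n, key N, hN n hn]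

/-- The exponentials are isometric, so `x` evolved to time `r'` may be replaced by its limit `y`
before the remaining evolution. -/
lemma tendsto_exp_apply_add (hT : ∀ n, T n ∈ skewAdjoint (H →L[ℂ] H)) {r r' : ℝ} {x y z : H}
    (h' : Tendsto (fun n => NormedSpace.exp (r' • T n) x) atTop (𝓝 y))
    (h : Tendsto (fun n => NormedSpace.exp (r • T n) y) atTop (𝓝 z)) :
    Tendsto (fun n => NormedSpace.exp ((r + r') • T n) x) atTop (𝓝 z) := by
  have h0 : Tendsto (fun n => NormedSpace.exp (r • T n) (NormedSpace.exp (r' • T n) x) -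
      NormedSpace.exp (r • T n) y) atTop (𝓝 0) := by
    rw [tendsto_zero_iff_norm_tendsto_zero]
    simp_rw [← map_sub, norm_exp_smul_apply (hT _)]
    exact tendsto_iff_norm_sub_tendsto_zero.1 h'
  simpa [exp_add_smul_apply] using h0.add h

lemma exists_tendsto_exp_apply (hT : ∀ n, T n ∈ skewAdjoint (H →L[ℂ] H))
    (hTA : ∀ ψ, ∀ᶠ n in atTop, T n (ι ψ) = ι (A ψ)) (hι : DenseRange ι) {R : ℝ} (hR : 0 < R)
    (hA : ∀ ψ, Tendsto (fun j : ℕ => R ^ j / j.factorial * ‖ι ((A ^ j) ψ)‖) atTop (𝓝 0))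
    (r : ℝ) (x : H) : ∃ y, Tendsto (fun n => NormedSpace.exp (r • T n) x) atTop (𝓝 y) := by
  have small (r : ℝ) (hr : |r| ≤ R) (x : H) :
      ∃ y, Tendsto (fun n => NormedSpace.exp (r • T n) x) atTop (𝓝 y) := by
    refine cauchySeq_tendsto_of_complete (cauchySeq_exp_apply_of_denseRange hT hι (fun ψ => ?_) x)
    refine cauchySeq_exp_apply_of_analytic hT hTA
      (squeeze_zero (fun j => by positivity) (fun j => ?_) (hA ψ))
    gcongr
  -- The time `r` is cut into `N` steps of length at most the common radius `R`; a radius depending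
  -- on the vector would not suffice, since intermediate limits leave the range of `ι`.
  obtain ⟨N, hN⟩ := exists_nat_gt (|r| / R)
  have hN0 : (0 : ℝ) < N := lt_of_le_of_lt (by positivity) hN
  have hs : |r / N| ≤ R := by
    rw [abs_div, Nat.abs_cast, div_le_iff₀ hN0, mul_comm]
    exact ((div_lt_iff₀ hR).1 hN).le
  have multiples (j : ℕ) (x : H) :
      ∃ y, Tendsto (fun n => NormedSpace.exp ((j * (r / N)) • T n) x) atTop (𝓝 y) := by
    induction j generalizing x with
    | zero => exact small _ (by simp [hR.le]) x
    | succ j ih =>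
      obtain ⟨y, hy⟩ := small _ hs x
      obtain ⟨z, hz⟩ := ih y
      refine ⟨z, ?_⟩
      simpa [add_mul] using tendsto_exp_apply_add hT hy hz
  obtain ⟨y, hy⟩ := multiples N x
  exact ⟨y, by rwa [mul_div_cancel₀ _ hN0.ne'] at hy⟩

/-- A densely defined operator that is the eventual restriction of bounded skew-adjoint operators and
whose domain consists of vectors analytic with a common radius generates a unitary group. -/
theorem exists_isUnitaryGroup_hasDerivAt (hT : ∀ n, T n ∈ skewAdjoint (H →L[ℂ] H))
    (hTA : ∀ ψ, ∀ᶠ n in atTop, T n (ι ψ) = ι (A ψ)) (hι : DenseRange ι) {R : ℝ} (hR : 0 < R)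
    (hA : ∀ ψ, Tendsto (fun j : ℕ => R ^ j / j.factorial * ‖ι ((A ^ j) ψ)‖) atTop (𝓝 0)) :
    ∃ U : ℝ → (H ≃ₗᵢ[ℂ] H), IsUnitaryGroup U ∧
      ∀ ψ, HasDerivAt (fun r : ℝ => U r (ι ψ)) (ι (A ψ)) 0 := by
  choose V hV using exists_tendsto_exp_apply hT hTA hι hR hA
  have hV_add (r r' : ℝ) (x : H) : V (r + r') x = V r (V r' x) :=
    tendsto_nhds_unique (hV _ x) (tendsto_exp_apply_add hT (hV r' x) (hV r (V r' x)))
  have hV_zero (x : H) : V 0 x = x :=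
    tendsto_nhds_unique (hV 0 x) (by simp)
  have hV_norm (r : ℝ) (x : H) : ‖V r x‖ = ‖x‖ :=
    tendsto_nhds_unique (hV r x).norm (by simp [norm_exp_smul_apply (hT _)])
  let L (r : ℝ) : H →ₗ[ℂ] H :=
    { toFun := V r
      map_add' := fun x y => tendsto_nhds_unique (hV r (x + y)) (by
        simpa using (hV r x).add (hV r y))
      map_smul' := fun c x => tendsto_nhds_unique (hV r (c • x)) (by
        simpa using (hV r x).const_smul c) }
  let U (r : ℝ) : H ≃ₗᵢ[ℂ] H :=
    { toLinearEquiv := LinearEquiv.ofLinearMap (L r) (L (-r))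
        (by ext x; change V r (V (-r) x) = x; rw [← hV_add, add_neg_cancel, hV_zero])
        (by ext x; change V (-r) (V r x) = x; rw [← hV_add, neg_add_cancel, hV_zero])
      norm_map' := hV_norm r }
  have hU (r : ℝ) (x : H) : U r x = V r x := rfl
  -- The second-order remainder bound is uniform in `n`, so it survives the limit and gives the
  -- derivative at `0`.
  have taylor (r : ℝ) (ψ : E) :
      ‖V r (ι ψ) - ι ψ - r • ι (A ψ)‖ ≤ |r| ^ 2 / 2 * ‖ι ((A ^ 2) ψ)‖ := by
    have hlim := (((hV r (ι ψ)).sub_const (ι ψ)).sub_const (r • ι (A ψ))).norm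
    refine le_of_tendsto hlim ?_
    filter_upwards [hTA ψ, eventually_pow_apply_eq hTA 2 ψ] with n h1 h2
    have h := norm_exp_smul_sub_sum_le_abs (hT n) 2 (ι ψ) r
    rw [h2] at h
    simpa [Finset.sum_range_succ, h1, sub_sub] using h
  have hderiv (ψ : E) : HasDerivAt (fun r : ℝ => U r (ι ψ)) (ι (A ψ)) 0 := by
    rw [hasDerivAt_iff_isLittleO_nhds_zero]
    have h2 : (fun h : ℝ => |h| ^ 2 / 2 * ‖ι ((A ^ 2) ψ)‖) =o[𝓝 0] fun h => h := by
      have : (fun h : ℝ => h ^ 2) =o[𝓝 0] fun h => h := by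
        simpa using Asymptotics.isLittleO_pow_id (𝕜 := ℝ) one_lt_two
      refine (this.const_mul_left (‖ι ((A ^ 2) ψ)‖ / 2)).congr_left fun h => ?_
      rw [sq_abs]; ring
    refine Asymptotics.IsBigO.trans_isLittleO (Asymptotics.IsBigO.of_norm_le fun h => ?_) h2
    simpa only [hU, zero_add, hV_zero] using taylor h ψ
  refine ⟨U, ⟨hV_add, fun x => ?_⟩, hderiv⟩
  -- Continuity at `0` passes from the dense range of `ι` to all of `H` by isometry; the group law
  -- then moves it to any time.
  have hcont0 (x : H) : Tendsto (fun r => V r x) (𝓝 0) (𝓝 x) := by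
    rw [Metric.tendsto_nhds]
    intro ε hε
    obtain ⟨ψ, hψ⟩ := hι.exists_dist_lt x (by positivity : 0 < ε / 3)
    have hc := (hderiv ψ).continuousAt.tendsto
    simp only [hU, hV_zero] at hc
    filter_upwards [Metric.tendsto_nhds.1 hc (ε / 3) (by positivity)] with r hr
    have h1 : dist (V r x) (V r (ι ψ)) = dist x (ι ψ) := (U r).dist_map x (ι ψ)
    have h2 := dist_triangle4 (V r x) (V r (ι ψ)) (ι ψ) x
    rw [dist_comm (ι ψ) x] at h2
    linarith
  rw [continuous_iff_continuousAt]
  intro r₀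
  have hshift : Tendsto (fun r => V (r - r₀) x) (𝓝 r₀) (𝓝 x) := by
    refine (hcont0 x).comp ?_
    simpa using (continuous_id.sub continuous_const).tendsto r₀ (f := fun r => r - r₀)
  have := ((U r₀).continuous.tendsto x).comp hshift
  refine this.congr fun r => ?_
  change V r₀ (V (r - r₀) x) = V r x
  rw [← hV_add, add_sub_cancel]

end UnitaryLimit

/-! ### Photon-number cut-offs, analytic vectors and existence -/

lemma sqrt_succ_mul_sqrt_succ_le {K k m : ℕ} (hk : k ≤ K) (hm : m ≤ K) :
    √((k : ℝ) + 1) * √((m : ℝ) + 1) ≤ K + 1 :=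
  calc √((k : ℝ) + 1) * √((m : ℝ) + 1) ≤ √((K : ℝ) + 1) * √((K : ℝ) + 1) := by gcongr
    _ = K + 1 := Real.mul_self_sqrt (by positivity)

lemma sqrt_mul_sqrt_le {K k m : ℕ} (hk : k ≤ K) (hm : m ≤ K) :
    √(k : ℝ) * √(m : ℝ) ≤ K + 1 := by
  refine le_trans ?_ (sqrt_succ_mul_sqrt_succ_le hk hm)
  gcongr <;> linarith

namespace FiniteFock

lemma squeezeExponent_single (ω : ℂ) (k m : ℕ) :
    squeezeExponent ω (Finsupp.single (k, m) 1) =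
      (conj ω * (√(k : ℝ) * √(m : ℝ) : ℝ)) • Finsupp.single (k - 1, m - 1) (1 : ℂ) -
      (ω * (√((k : ℝ) + 1) * √((m : ℝ) + 1) : ℝ)) • Finsupp.single (k + 1, m + 1) (1 : ℂ) := by
  simp [squeezeExponent, annR, annI, creR, creI, Finsupp.linearCombination_single, -Finsupp.single_mul,
    mul_comm]

section

variable {H : Type*} [NormedAddCommGroup H] [InnerProductSpace ℂ H] (b : HilbertBasis (ℕ × ℕ) ℂ H)

@[simp] lemma toHilbert_single (p : ℕ × ℕ) (c : ℂ) :
    toHilbert b (Finsupp.single p c) = c • b p := by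
  simp [toHilbert, Finsupp.linearCombination_single]

lemma toHilbert_squeezeExponent_single (ω : ℂ) (k m : ℕ) :
    toHilbert b (squeezeExponent ω (Finsupp.single (k, m) 1)) =
      (conj ω * (√(k : ℝ) * √(m : ℝ) : ℝ)) • b (k - 1, m - 1) -
      (ω * (√((k : ℝ) + 1) * √((m : ℝ) + 1) : ℝ)) • b (k + 1, m + 1) := by
  rw [squeezeExponent_single, map_sub, map_smul, map_smul, toHilbert_single, toHilbert_single,
    one_smul, one_smul]

lemma denseRange_toHilbert : DenseRange (toHilbert b) := by
  rw [DenseRange, ← LinearMap.coe_range, toHilbert, Finsupp.range_linearCombination]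
  exact Submodule.dense_iff_topologicalClosure_eq_top.2 b.dense_span

/-- The product of the two annihilation operators, cut off at `N` photons in each mode. -/
noncomputable def lowerTrunc (N : ℕ) : H →L[ℂ] H :=
  ∑ p ∈ Finset.range N ×ˢ Finset.range N,
    ((√((p.1 : ℝ) + 1) * √((p.2 : ℝ) + 1) : ℝ) : ℂ) •
      InnerProductSpace.rankOne ℂ (b p) (b (p.1 + 1, p.2 + 1))

/-- The product of the two creation operators, cut off at `N` photons in each mode. -/
noncomputable def raiseTrunc (N : ℕ) : H →L[ℂ] H :=
  ∑ p ∈ Finset.range N ×ˢ Finset.range N,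
    ((√((p.1 : ℝ) + 1) * √((p.2 : ℝ) + 1) : ℝ) : ℂ) •
      InnerProductSpace.rankOne ℂ (b (p.1 + 1, p.2 + 1)) (b p)

lemma inner_basis (p q : ℕ × ℕ) : inner ℂ (b p) (b q) = if p = q then (1 : ℂ) else 0 :=
  orthonormal_iff_ite.1 b.orthonormal p q

lemma lowerTrunc_apply {N k m : ℕ} (hk : k < N) (hm : m < N) :
    lowerTrunc b N (b (k, m)) = ((√(k : ℝ) * √(m : ℝ) : ℝ) : ℂ) • b (k - 1, m - 1) := by
  simp only [lowerTrunc, sum_apply, smul_apply, InnerProductSpace.rankOne_apply, inner_basis]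
  rcases k with _ | k
  · simp
  rcases m with _ | m
  · simp
  rw [Finset.sum_eq_single (k, m)]
  · simp
  · rintro ⟨i, j⟩ _ hne
    rw [if_neg (by simpa using hne)]
    simp
  · intro h
    simp only [Finset.mem_product, Finset.mem_range] at h
    omega

lemma raiseTrunc_apply {N k m : ℕ} (hk : k < N) (hm : m < N) :
    raiseTrunc b N (b (k, m)) =
      ((√((k : ℝ) + 1) * √((m : ℝ) + 1) : ℝ) : ℂ) • b (k + 1, m + 1) := by
  simp only [raiseTrunc, sum_apply, smul_apply, InnerProductSpace.rankOne_apply, inner_basis]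
  rw [Finset.sum_eq_single (k, m)]
  · simp
  · rintro ⟨i, j⟩ _ hne
    rw [if_neg hne]
    simp
  · intro h
    simp only [Finset.mem_product, Finset.mem_range] at h
    omega

/-- The exponent of the squeezing operator, cut off at `N` photons in each mode. -/
noncomputable def exponentTrunc (ω : ℂ) (N : ℕ) : H →L[ℂ] H :=
  conj ω • lowerTrunc b N - ω • raiseTrunc b N

lemma exponentTrunc_mem_skewAdjoint [CompleteSpace H] (ω : ℂ) (N : ℕ) :
    exponentTrunc b ω N ∈ skewAdjoint (H →L[ℂ] H) := by
  have h1 : star (lowerTrunc b N) = raiseTrunc b N := by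
    simp only [lowerTrunc, raiseTrunc, star_sum, star_smul, ContinuousLinearMap.star_eq_adjoint,
      InnerProductSpace.adjoint_rankOne, RCLike.star_def, Complex.conj_ofReal]
  have h2 : star (raiseTrunc b N) = lowerTrunc b N := by rw [← h1, star_star]
  rw [skewAdjoint.mem_iff, exponentTrunc, star_sub, star_smul, star_smul, h1, h2]
  simp

lemma eventually_exponentTrunc_apply (ω : ℂ) (ψ : FiniteFock) :
    ∀ᶠ N in atTop, exponentTrunc b ω N (toHilbert b ψ) = toHilbert b (squeezeExponent ω ψ) := by
  induction ψ using Finsupp.induction_linear with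
  | zero => simp
  | add f g hf hg =>
    filter_upwards [hf, hg] with N h1 h2
    simp only [map_add, h1, h2]
  | single p c =>
    obtain ⟨k, m⟩ := p
    filter_upwards [eventually_gt_atTop k, eventually_gt_atTop m] with N hk hm
    have : (Finsupp.single (k, m) c : FiniteFock) = c • Finsupp.single (k, m) 1 := by simp
    rw [this, map_smul, map_smul, map_smul, map_smul, toHilbert_squeezeExponent_single,
      toHilbert_single, one_smul, exponentTrunc, sub_apply, smul_apply,
      smul_apply, lowerTrunc_apply b hk hm, raiseTrunc_apply b hk hm, smul_smul, smul_smul]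

/-- Peeling off the first application gives two states with photon numbers at most `K + 1`, each
with coefficient at most `‖ω‖ (K + 1)`. Bounding the lowered state by `K + 1` as well keeps the
induction uniform. -/
lemma norm_squeezeExponent_pow_single_le (ω : ℂ) (j : ℕ) {K k m : ℕ} (hk : k ≤ K) (hm : m ≤ K) :
    ‖toHilbert b ((squeezeExponent ω ^ j) (Finsupp.single (k, m) 1))‖ ≤
      (2 * ‖ω‖) ^ j * (K + 1).ascFactorial j := by
  induction j generalizing K k m with
  | zero => simp [b.orthonormal.1]
  | succ j ih =>
    have h1 := ih (K := K + 1) (k := k - 1) (m := m - 1) (by omega) (by omega)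
    have h2 := ih (K := K + 1) (k := k + 1) (m := m + 1) (by omega) (by omega)
    rw [pow_succ, Module.End.mul_apply, squeezeExponent_single, map_sub, map_sub, map_smul, map_smul,
      map_smul, map_smul]
    refine (norm_sub_le _ _).trans ?_
    rw [norm_smul, norm_smul, norm_mul, norm_mul, RCLike.norm_conj, Complex.norm_real,
      Complex.norm_real, Real.norm_of_nonneg (by positivity), Real.norm_of_nonneg (by positivity)]
    have e1 := sqrt_mul_sqrt_le hk hm
    have e2 := sqrt_succ_mul_sqrt_succ_le hk hm
    have e3 : ((K + 1).ascFactorial (j + 1) : ℝ) = (K + 1) * (K + 1 + 1).ascFactorial j := by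
      rw [Nat.ascFactorial_succ, ← Nat.succ_ascFactorial]
      push_cast
      rfl
    rw [e3]
    calc _ ≤ ‖ω‖ * (K + 1) * ((2 * ‖ω‖) ^ j * (K + 1 + 1).ascFactorial j) +
          ‖ω‖ * (K + 1) * ((2 * ‖ω‖) ^ j * (K + 1 + 1).ascFactorial j) := by gcongr
      _ = _ := by ring

lemma tendsto_squeezeExponent_pow (ω : ℂ) (ψ : FiniteFock) :
    Tendsto (fun j : ℕ => (1 / (8 * ‖ω‖ + 1)) ^ j / j.factorial *
      ‖toHilbert b ((squeezeExponent ω ^ j) ψ)‖) atTop (𝓝 0) := by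
  induction ψ using Finsupp.induction_linear with
  | zero => simp
  | add f g hf hg =>
    have h := hf.add hg
    rw [add_zero] at h
    refine squeeze_zero (fun j => by positivity) (fun j => ?_) h
    rw [map_add, map_add, ← mul_add]
    gcongr
    exact norm_add_le _ _
  | single p c =>
    obtain ⟨k, m⟩ := p
    have hc : (Finsupp.single (k, m) c : FiniteFock) = c • Finsupp.single (k, m) 1 := by simp
    set K := max k m
    have hgeom : Tendsto (fun j : ℕ => ‖c‖ * 2 ^ K * ((1 / 2 : ℝ)) ^ j) atTop (𝓝 0) := by
      simpa using (tendsto_pow_atTop_nhds_zero_of_lt_one (r := (1 / 2 : ℝ)) (by norm_num)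
        (by norm_num)).const_mul (‖c‖ * 2 ^ K)
    refine squeeze_zero (fun j => by positivity) (fun j => ?_) hgeom
    rw [hc, map_smul, map_smul, norm_smul]
    have hb := norm_squeezeExponent_pow_single_le b ω j (le_max_left k m) (le_max_right k m)
    have hch : ((K + 1).ascFactorial j : ℝ) ≤ j.factorial * 2 ^ (K + j) := by
      rw [Nat.ascFactorial_eq_factorial_mul_choose]
      exact_mod_cast Nat.mul_le_mul_left _ (Nat.choose_le_two_pow _ _)
    -- The radius `1 / (8‖ω‖ + 1)` is chosen so that, with the binomial bound `2 ^ (K + j)`, the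
    -- ratio is at most `1/2`; the `+ 1` covers `ω = 0`.
    have hbase : 1 / (8 * ‖ω‖ + 1) * (2 * ‖ω‖) * 2 ≤ 1 / 2 := by
      rw [div_mul_eq_mul_div, div_mul_eq_mul_div, div_le_div_iff₀ (by positivity) (by norm_num)]
      linarith
    calc _ ≤ (1 / (8 * ‖ω‖ + 1)) ^ j / j.factorial *
          (‖c‖ * ((2 * ‖ω‖) ^ j * (j.factorial * 2 ^ (K + j)))) := by
          gcongr
          exact hb.trans (by gcongr)
      _ = ‖c‖ * 2 ^ K * (1 / (8 * ‖ω‖ + 1) * (2 * ‖ω‖) * 2) ^ j := by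
          rw [mul_pow (1 / (8 * ‖ω‖ + 1) * (2 * ‖ω‖)), mul_pow (1 / (8 * ‖ω‖ + 1)), pow_add]
          generalize (1 / (8 * ‖ω‖ + 1)) ^ j = x
          field_simp
      _ ≤ _ := by gcongr

end

end FiniteFock

theorem exists_isTwoModeSqueezer {H : Type*} [NormedAddCommGroup H] [InnerProductSpace ℂ H]
    [CompleteSpace H] (b : HilbertBasis (ℕ × ℕ) ℂ H) (ω : ℂ) :
    ∃ S : H ≃ₗᵢ[ℂ] H, IsTwoModeSqueezer b ω S := by
  obtain ⟨U, hU, hderiv⟩ := exists_isUnitaryGroup_hasDerivAt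
    (FiniteFock.exponentTrunc_mem_skewAdjoint b ω) (FiniteFock.eventually_exponentTrunc_apply b ω)
    (FiniteFock.denseRange_toHilbert b) (R := 1 / (8 * ‖ω‖ + 1)) (by positivity)
    (FiniteFock.tendsto_squeezeExponent_pow b ω)
  exact ⟨U 1, U, hU, hderiv, rfl⟩

/-! ### Uniqueness for the evolution of matrix elements -/

/-- The evolution equation of the matrix elements `⟨x| U(r) |k m⟩` of the squeezing group. -/
def IsSqueezeEvolution (ω : ℂ) (F : ℕ → ℕ → ℝ → ℂ) : Prop :=
  ∀ k m r, HasDerivAt (F k m)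
    (conj ω * (√(k : ℝ) * √(m : ℝ) : ℝ) * F (k - 1) (m - 1) r -
      ω * (√((k : ℝ) + 1) * √((m : ℝ) + 1) : ℝ) * F (k + 1) (m + 1) r) r

namespace IsSqueezeEvolution

variable {ω : ℂ} {F : ℕ → ℕ → ℝ → ℂ}

lemma sub {G : ℕ → ℕ → ℝ → ℂ} (hF : IsSqueezeEvolution ω F) (hG : IsSqueezeEvolution ω G) :
    IsSqueezeEvolution ω fun k m r => F k m r - G k m r := fun k m r =>
  ((hF k m r).sub (hG k m r)).congr_deriv (by ring)

/-- Integrating the system `j` times raises the photon bound from `N` to `N + j`. The coefficients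
contribute `(N + 1) ⋯ (N + j)`, the time integrals `1 / j!`, and together these form the binomial
coefficient. -/
lemma norm_le_choose (hF : IsSqueezeEvolution ω F) {M K : ℝ}
    (hbound : ∀ N k m r, k ≤ N → m ≤ N → ‖F k m r‖ ≤ M * K ^ N) {a : ℝ}
    (ha : ∀ k m, F k m a = 0) (j : ℕ) {N k m : ℕ} (hk : k ≤ N) (hm : m ≤ N) {r : ℝ} (hr : a ≤ r) :
    ‖F k m r‖ ≤ M * K ^ N * (2 * ‖ω‖ * K * (r - a)) ^ j * (N + j).choose j := by
  induction j generalizing N k m r with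
  | zero => simpa using hbound N k m r hk hm
  | succ j ih =>
    set C := M * K ^ N * (2 * ‖ω‖ * K) ^ (j + 1)
    refine (image_norm_le_of_norm_deriv_right_le_deriv_boundary (a := a) (b := r)
      (fun t _ => (hF k m t).continuousAt.continuousWithinAt)
      (fun t _ => (hF k m t).hasDerivWithinAt)
      (B := fun t => C * (t - a) ^ (j + 1) * (N + (j + 1)).choose (j + 1))
      (B' := fun t => C * ((j + 1) * (t - a) ^ j) * (N + (j + 1)).choose (j + 1))
      (by simp [ha]) (fun t => ?_) (fun t ht => ?_) ⟨hr, le_rfl⟩).trans_eq ?_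
    · have := ((hasDerivAt_id t).sub_const a).pow (j + 1)
      simpa using (this.const_mul C).mul_const ((N + (j + 1)).choose (j + 1) : ℝ)
    · have h1 := ih (N := N + 1) (k := k - 1) (m := m - 1) (by omega) (by omega) ht.1
      have h2 := ih (N := N + 1) (k := k + 1) (m := m + 1) (by omega) (by omega) ht.1
      set B := M * K ^ (N + 1) * (2 * ‖ω‖ * K * (t - a)) ^ j * (N + 1 + j).choose j with hB
      have hB0 : 0 ≤ B := (norm_nonneg _).trans h1
      refine (norm_sub_le _ _).trans ?_
      rw [norm_mul, norm_mul, norm_mul, norm_mul, RCLike.norm_conj, Complex.norm_real,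
        Complex.norm_real, Real.norm_of_nonneg (by positivity), Real.norm_of_nonneg (by positivity)]
      have e1 := sqrt_mul_sqrt_le hk hm
      have e2 := sqrt_succ_mul_sqrt_succ_le hk hm
      have hch : ((N + (j + 1)).choose (j + 1) : ℝ) * (j + 1) = (N + 1 + j).choose j * (N + 1) := by
        have := Nat.choose_succ_right_eq (N + (j + 1)) j
        rw [show N + (j + 1) - j = N + 1 by omega, show N + (j + 1) = N + 1 + j by omega] at this
        rw [show N + (j + 1) = N + 1 + j by omega]
        exact_mod_cast this
      calc _ ≤ ‖ω‖ * (N + 1) * B + ‖ω‖ * (N + 1) * B := by gcongr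
        _ = M * K ^ N * (2 * ‖ω‖ * K) ^ (j + 1) * (t - a) ^ j *
            ((N + 1 + j).choose j * (N + 1)) := by rw [hB, mul_pow _ (t - a)]; ring
        _ = _ := by rw [← hch]; ring
    · simp only [C, mul_pow _ (r - a)]
      ring

/-- Solutions of the evolution equation of at most exponential growth are determined by their
initial values. -/
lemma eq_zero (hF : IsSqueezeEvolution ω F) {M K : ℝ} (hM : 0 ≤ M) (hK : 1 ≤ K)
    (hbound : ∀ N k m r, k ≤ N → m ≤ N → ‖F k m r‖ ≤ M * K ^ N)
    (h0 : ∀ k m, F k m 0 = 0) (k m : ℕ) {r : ℝ} (hr : 0 ≤ r) : F k m r = 0 := by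
  have hK0 : 0 < K := by linarith
  -- With this `δ` the ratio `4 ‖ω‖ K (r - a)` is at most `1/2` on `[a, a + δ]`. It does not depend
  -- on `a`, `k` or `m`, so the vanishing of all components propagates along a grid of step `δ`.
  set δ := 1 / (8 * ‖ω‖ * K + 1) with hδ
  have hδ0 : 0 < δ := by positivity
  have step {a : ℝ} (ha : ∀ k m, F k m a = 0) (k m : ℕ) {r : ℝ} (har : a ≤ r) (hra : r ≤ a + δ) :
      F k m r = 0 := by
    set N := max k m
    have hlim : Tendsto (fun j : ℕ => M * K ^ N * 2 ^ N * (1 / 2 : ℝ) ^ j) atTop (𝓝 0) := by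
      simpa using (tendsto_pow_atTop_nhds_zero_of_lt_one (r := (1 / 2 : ℝ)) (by norm_num)
        (by norm_num)).const_mul (M * K ^ N * 2 ^ N)
    refine norm_le_zero_iff.1 (ge_of_tendsto' hlim fun j => ?_)
    have hra0 : 0 ≤ r - a := sub_nonneg.2 har
    have hq : 2 * ‖ω‖ * K * (r - a) * 2 ≤ 1 / 2 := by
      have : 8 * ‖ω‖ * K * δ ≤ 1 := by
        rw [hδ, mul_one_div, div_le_one (by positivity)]
        linarith
      have : ‖ω‖ * K * (r - a) ≤ ‖ω‖ * K * δ := by gcongr; linarith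
      linarith
    have hch : ((N + j).choose j : ℝ) ≤ 2 ^ (N + j) := by exact_mod_cast Nat.choose_le_two_pow _ _
    calc _ ≤ M * K ^ N * (2 * ‖ω‖ * K * (r - a)) ^ j * (N + j).choose j :=
          hF.norm_le_choose hbound ha j (le_max_left k m) (le_max_right k m) har
      _ ≤ M * K ^ N * (2 * ‖ω‖ * K * (r - a)) ^ j * 2 ^ (N + j) := by gcongr
      _ = M * K ^ N * 2 ^ N * (2 * ‖ω‖ * K * (r - a) * 2) ^ j := by
          rw [mul_pow _ 2, pow_add]; ring
      _ ≤ _ := by gcongr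
  have grid (n : ℕ) (k m : ℕ) : F k m (n * δ) = 0 := by
    induction n generalizing k m with
    | zero => simpa using h0 k m
    | succ n ih =>
      refine step ih k m ?_ ?_ <;> push_cast <;> linarith
  obtain hn := Nat.floor_le (div_nonneg hr hδ0.le)
  have hn' := Nat.lt_floor_add_one (r / δ)
  refine step (grid ⌊r / δ⌋₊) k m ((le_div_iff₀ hδ0).1 hn) ?_
  rw [div_lt_iff₀ hδ0] at hn'
  linarith

end IsSqueezeEvolution

section

variable {H : Type*} [NormedAddCommGroup H] [InnerProductSpace ℂ H]

lemma IsUnitaryGroup.hasDerivAt {U : ℝ → (H ≃ₗᵢ[ℂ] H)} (hU : IsUnitaryGroup U) {x y : H}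
    (h : HasDerivAt (fun r => U r x) y 0) (r : ℝ) : HasDerivAt (fun r => U r x) (U r y) r := by
  have h' : HasDerivAt (fun t => U (t - r) x) y r := by
    have : HasDerivAt (fun r => U r x) y (r - r) := by rwa [sub_self]
    exact this.comp_sub_const r r
  have h2 := (((U r).toContinuousLinearEquiv : H →L[ℂ] H).restrictScalars ℝ).hasFDerivAt.comp_hasDerivAt
    r h'
  refine h2.congr_of_eventuallyEq (Eventually.of_forall fun t => ?_)
  change U t x = U r (U (t - r) x)
  rw [← hU.map_add, add_sub_cancel]

lemma IsUnitaryGroup.apply_zero {U : ℝ → (H ≃ₗᵢ[ℂ] H)} (hU : IsUnitaryGroup U) (x : H) :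
    U 0 x = x :=
  (U 0).injective (by rw [← hU.map_add, add_zero])

lemma IsUnitaryGroup.isSqueezeEvolution {U : ℝ → (H ≃ₗᵢ[ℂ] H)} (hU : IsUnitaryGroup U)
    (b : HilbertBasis (ℕ × ℕ) ℂ H) (ω : ℂ)
    (hderiv : ∀ ψ : FiniteFock, HasDerivAt (fun r : ℝ => U r (FiniteFock.toHilbert b ψ))
      (FiniteFock.toHilbert b (FiniteFock.squeezeExponent ω ψ)) 0) (x : H) :
    IsSqueezeEvolution ω fun k m r => inner ℂ x (U r (b (k, m))) := by
  intro k m r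
  have h := hderiv (Finsupp.single (k, m) 1)
  rw [FiniteFock.toHilbert_squeezeExponent_single] at h
  simp only [FiniteFock.toHilbert_single, one_smul] at h
  have h2 := ((innerSL ℂ x).restrictScalars ℝ).hasFDerivAt.comp_hasDerivAt r (hU.hasDerivAt h r)
  refine h2.congr_deriv ?_
  simp [inner_sub_right, inner_smul_right]

end

/-! ### Divided powers and the derivative of the explicit sum -/

/-- The divided power `x ^ n / n!`, extended by zero to negative `n`. -/
noncomputable def zdivPow (x : ℂ) (n : ℤ) : ℂ := if 0 ≤ n then x ^ n.toNat / n.toNat.factorial else 0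

lemma zdivPow_natCast (x : ℂ) (n : ℕ) : zdivPow x n = x ^ n / n.factorial := by simp [zdivPow]

lemma zdivPow_of_neg (x : ℂ) {n : ℤ} (hn : n < 0) : zdivPow x n = 0 := by simp [zdivPow, hn]

/-- Extension by zero makes this recurrence hold for every integer, so sums over intermediate photon
numbers need no boundary cases. -/
lemma mul_zdivPow (x : ℂ) (n : ℤ) : n * zdivPow x n = x * zdivPow x (n - 1) := by
  rcases lt_trichotomy n 0 with hn | rfl | hn
  · rw [zdivPow_of_neg x hn, zdivPow_of_neg x (by omega)]; simp
  · rw [zdivPow_of_neg x (n := 0 - 1) (by norm_num)]; simp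
  · obtain ⟨j, rfl⟩ : ∃ j : ℕ, n = (j + 1 : ℕ) := ⟨n.toNat - 1, by omega⟩
    rw [show ((j + 1 : ℕ) : ℤ) - 1 = (j : ℕ) by push_cast; ring, zdivPow_natCast, zdivPow_natCast,
      Nat.factorial_succ]
    have : (j.factorial : ℂ) ≠ 0 := by exact_mod_cast j.factorial_ne_zero
    have : (j : ℂ) + 1 ≠ 0 := by exact_mod_cast j.succ_ne_zero
    push_cast
    field_simp
    ring

lemma HasDerivAt.zdivPow {g : ℝ → ℂ} {g' : ℂ} {r : ℝ} (hg : HasDerivAt g g' r) (n : ℤ) :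
    HasDerivAt (fun r => zdivPow (g r) n) (_root_.zdivPow (g r) (n - 1) * g') r := by
  rcases lt_trichotomy n 0 with hn | rfl | hn
  · simp only [zdivPow_of_neg _ hn, zdivPow_of_neg _ (show n - 1 < 0 by omega), zero_mul]
    exact hasDerivAt_const r 0
  · rw [zdivPow_of_neg _ (n := 0 - 1) (by norm_num), zero_mul]
    simpa [_root_.zdivPow] using hasDerivAt_const r (1 : ℂ)
  · obtain ⟨j, rfl⟩ : ∃ j : ℕ, n = (j + 1 : ℕ) := ⟨n.toNat - 1, by omega⟩
    rw [show ((j + 1 : ℕ) : ℤ) - 1 = (j : ℕ) by push_cast; ring]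
    simp only [zdivPow_natCast]
    refine ((hg.pow (j + 1)).div_const ((j + 1).factorial : ℂ)).congr_deriv ?_
    have : (j.factorial : ℂ) ≠ 0 := by exact_mod_cast j.factorial_ne_zero
    have : (j : ℂ) + 1 ≠ 0 := by exact_mod_cast j.succ_ne_zero
    rw [Nat.factorial_succ]
    push_cast
    field_simp

lemma norm_zdivPow_le_one {x : ℂ} (hx : ‖x‖ ≤ 1) (n : ℤ) : ‖zdivPow x n‖ ≤ 1 := by
  unfold zdivPow
  split_ifs
  · rw [norm_div, norm_pow, Complex.norm_natCast]
    exact div_le_one_of_le₀ ((pow_le_one₀ (norm_nonneg _) hx).trans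
      (by exact_mod_cast Nat.one_le_iff_ne_zero.2 (Nat.factorial_ne_zero _))) (by positivity)
  · simp

/-- The summand of the squeezing matrix element, without the square root of factorials:
`l` photons in mode `R` and `l + d` in mode `I` remain after the lowering factor has acted. -/
noncomputable def squeezeTerm (τ σ ν : ℂ) (s k d l : ℤ) : ℂ :=
  zdivPow (-τ) (s - l) * zdivPow σ (k - l) * ν ^ (-(2 * l + d + 1)) *
    (zdivPow 1 l * zdivPow 1 (l + d))

/-- The squeezing matrix element from `|k, k + d⟩` to `|s, s + d⟩`, without the square root of
factorials. -/
noncomputable def squeezeSum (τ σ ν : ℂ) (s : ℕ) (k d : ℤ) : ℂ :=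
  ∑ l ∈ Finset.range (s + 1), squeezeTerm τ σ ν s k d l

/-- This is the evolution equation after division by the square root of factorials. It fails term by
term, but the defect of the `l`-th term is `G l - G (l + 1)`, and both ends of this telescoping sum
vanish because they contain a divided power of exponent `-1`. -/
lemma hasDerivAt_squeezeSum {τ σ ν : ℝ → ℂ} {ω ω' : ℂ} {r : ℝ}
    (hτ : HasDerivAt τ (ω * ν r ^ (-2 : ℤ)) r) (hσ : HasDerivAt σ (ω' * ν r ^ (-2 : ℤ)) r)
    (hν : HasDerivAt ν (ν r * (ω' * τ r)) r) (hν0 : ν r ≠ 0)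
    (hsech : ν r ^ (-2 : ℤ) = 1 - τ r * σ r) (hphase : ω * σ r = ω' * τ r) (s : ℕ) (k d : ℤ) :
    HasDerivAt (fun r => squeezeSum (τ r) (σ r) (ν r) s k d)
      (ω' * squeezeSum (τ r) (σ r) (ν r) s (k - 1) d -
        ω * ((k + 1) * (k + 1 + d)) * squeezeSum (τ r) (σ r) (ν r) s (k + 1) d) r := by
  set w := ν r ^ (-2 : ℤ) with hw
  have hterm (l : ℕ) := (((hτ.neg.zdivPow (s - l)).mul (hσ.zdivPow (k - l))).mul
    ((hasDerivAt_zpow (-(2 * l + d + 1)) (ν r) (.inl hν0)).comp r hν)).mul_const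
      (zdivPow 1 l * zdivPow 1 (l + d))
  refine (HasDerivAt.fun_sum fun l _ => hterm l).congr_deriv ?_
  let G (l : ℕ) : ℂ := ω * zdivPow (-τ r) (s - l) * zdivPow (σ r) (k + 1 - l) *
    ν r ^ (-(2 * (l : ℤ) + d + 1)) * (zdivPow 1 (l - 1) * zdivPow 1 (l + d - 1))
  have htel : ∑ l ∈ Finset.range (s + 1), (G l - G (l + 1)) = 0 := by
    rw [Finset.sum_range_sub']
    simp only [G]
    rw [zdivPow_of_neg 1 (n := ((0 : ℕ) : ℤ) - 1) (by norm_num),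
      zdivPow_of_neg (-τ r) (n := (s : ℤ) - (s + 1 : ℕ)) (by push_cast; omega)]
    ring
  rw [← sub_eq_zero, ← htel, squeezeSum, squeezeSum, Finset.mul_sum, Finset.mul_sum,
    ← Finset.sum_sub_distrib, ← Finset.sum_sub_distrib]
  refine Finset.sum_congr rfl fun l _ => ?_
  have hB1 := mul_zdivPow (σ r) (k + 1 - l)
  have hB0 := mul_zdivPow (σ r) (k - l)
  rw [show k + 1 - (l : ℤ) - 1 = k - l by ring] at hB1
  -- All reciprocal factorials are expressed through those of `l` and `l + d`, leaving a polynomial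
  -- identity modulo the relations among `τ`, `σ` and `ν`.
  have hQ : zdivPow 1 ((l : ℤ) - 1) * zdivPow 1 ((l : ℤ) + d - 1) =
      l * (l + d) * (zdivPow 1 l * zdivPow 1 (l + d)) := by
    have h1 := mul_zdivPow 1 (l : ℤ)
    have h2 := mul_zdivPow 1 ((l : ℤ) + d)
    push_cast at h1 h2
    linear_combination -(zdivPow 1 ((l : ℤ) + d - 1)) * h1 - l * zdivPow 1 l * h2
  have hN : ν r ^ (-(2 * (l : ℤ) + d + 1) - 1) * ν r = ν r ^ (-(2 * (l : ℤ) + d + 1)) := by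
    rw [← zpow_add_one₀ hν0]; congr 1; ring
  have hNw : ν r ^ (-(2 * ((l + 1 : ℕ) : ℤ) + d + 1)) = ν r ^ (-(2 * (l : ℤ) + d + 1)) * w := by
    rw [hw, ← zpow_add₀ hν0]; congr 1; push_cast; ring
  simp only [squeezeTerm, G, hQ, hNw, Pi.neg_apply, Pi.mul_apply, Function.comp_apply]
  rw [show (s : ℤ) - (l + 1 : ℕ) = s - l - 1 by push_cast; ring,
    show k + 1 - ((l + 1 : ℕ) : ℤ) = k - l by push_cast; ring,
    show ((l + 1 : ℕ) : ℤ) - 1 = l by push_cast; ring,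
    show ((l + 1 : ℕ) : ℤ) + d - 1 = l + d by push_cast; ring,
    show k - 1 - (l : ℤ) = k - l - 1 by ring]
  push_cast at hB1 hB0 ⊢
  generalize zdivPow (-τ r) (s - l) = a at *
  generalize zdivPow (-τ r) (s - l - 1) = am at *
  generalize zdivPow (σ r) (k + 1 - l) = b1 at *
  generalize zdivPow (σ r) (k - l) = b0 at *
  generalize zdivPow (σ r) (k - l - 1) = bm at *
  generalize ν r ^ (-(2 * (l : ℤ) + d + 1)) = n at *
  generalize ν r ^ (-(2 * (l : ℤ) + d + 1) - 1) = n1 at *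
  generalize zdivPow 1 l * zdivPow 1 (l + d) = q at *
  linear_combination a * n * q * (ω * (k + 1 - l - 1 + 2 * l + d + 1) * hB1 + ω * σ r * hB0 +
    ω' * bm * hsech + (σ r * bm + (2 * l + d + 1) * b0) * hphase) -
      a * b0 * q * (2 * l + d + 1) * ω' * τ r * hN

/-! ### The flow of `τ` and `ν` -/

/-- The parameter `τ` of the squeezing group at time `r`. -/
noncomputable def flowTau (ω : ℂ) (r : ℝ) : ℂ := ω / (‖ω‖ : ℝ) * (Real.tanh (r * ‖ω‖) : ℝ)

/-- The parameter `ν` of the squeezing group at time `r`. -/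
noncomputable def flowNu (ω : ℂ) (r : ℝ) : ℂ := (Real.cosh (r * ‖ω‖) : ℝ)

lemma flowTau_one (ω : ℂ) : flowTau ω 1 = squeezeTau ω := by simp [flowTau, squeezeTau]

lemma flowNu_one (ω : ℂ) : flowNu ω 1 = (squeezeNu ω : ℝ) := by simp [flowNu, squeezeNu]

lemma flowNu_ne_zero (ω : ℂ) (r : ℝ) : flowNu ω r ≠ 0 :=
  Complex.ofReal_ne_zero.2 (Real.cosh_pos _).ne'

lemma norm_flowTau_le_one (ω : ℂ) (r : ℝ) : ‖flowTau ω r‖ ≤ 1 := by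
  rw [flowTau, norm_mul, norm_div, Complex.norm_real, Complex.norm_real, norm_norm]
  exact mul_le_one₀ (div_self_le_one _) (norm_nonneg _) (Real.abs_tanh_lt_one _).le

lemma div_norm_mul_norm (ω : ℂ) : ω / (‖ω‖ : ℝ) * (‖ω‖ : ℝ) = ω := by
  rcases eq_or_ne ω 0 with rfl | h
  · simp
  · exact div_mul_cancel₀ _ (by simpa using h)

lemma conj_mul_div_norm (ω : ℂ) : conj ω * (ω / (‖ω‖ : ℝ)) = (‖ω‖ : ℝ) := by
  rcases eq_or_ne ω 0 with rfl | h
  · simp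
  · rw [← mul_div_assoc, Complex.conj_mul', sq, mul_div_assoc, div_self (by simpa using h), mul_one]

lemma conj_mul_flowTau (ω : ℂ) (r : ℝ) :
    conj ω * flowTau ω r = (‖ω‖ * Real.tanh (r * ‖ω‖) : ℝ) := by
  rw [flowTau, ← mul_assoc, conj_mul_div_norm, Complex.ofReal_mul]

/-- Both sides equal the real number `‖ω‖ tanh (r ‖ω‖)`: `τ` has the phase of `ω`. -/
lemma mul_conj_flowTau (ω : ℂ) (r : ℝ) : ω * conj (flowTau ω r) = conj ω * flowTau ω r := by
  have h := congrArg conj (conj_mul_flowTau ω r)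
  rw [map_mul, Complex.conj_conj, Complex.conj_ofReal] at h
  rw [h, conj_mul_flowTau]

lemma hasDerivAt_flowTau (ω : ℂ) (r : ℝ) :
    HasDerivAt (flowTau ω) (ω * flowNu ω r ^ (-2 : ℤ)) r := by
  have h : HasDerivAt (fun r : ℝ => Real.tanh (r * ‖ω‖)) (‖ω‖ / Real.cosh (r * ‖ω‖) ^ 2) r := by
    have hlin := (hasDerivAt_id r).mul_const ‖ω‖
    have h0 := (Real.cosh_pos (r * ‖ω‖)).ne'
    simp only [Real.tanh_eq_sinh_div_cosh]
    refine (hlin.sinh.div hlin.cosh h0).congr_deriv ?_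
    simp only [id_eq]
    congr 1
    linear_combination ‖ω‖ * Real.cosh_sq (r * ‖ω‖)
  refine (h.ofReal_comp.const_mul (ω / (‖ω‖ : ℝ))).congr_deriv ?_
  rw [flowNu, Complex.ofReal_div, ← mul_div_assoc, div_norm_mul_norm, zpow_neg, div_eq_mul_inv]
  norm_cast

lemma hasDerivAt_conj_flowTau (ω : ℂ) (r : ℝ) :
    HasDerivAt (fun r => conj (flowTau ω r)) (conj ω * flowNu ω r ^ (-2 : ℤ)) r := by
  refine (Complex.conjCLE.toContinuousLinearMap.hasFDerivAt.comp_hasDerivAt r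
    (hasDerivAt_flowTau ω r)).congr_deriv ?_
  have hν : conj (flowNu ω r) = flowNu ω r := Complex.conj_ofReal _
  change conj (ω * flowNu ω r ^ (-2 : ℤ)) = _
  rw [map_mul, map_zpow₀, hν]

lemma hasDerivAt_flowNu (ω : ℂ) (r : ℝ) :
    HasDerivAt (flowNu ω) (flowNu ω r * (conj ω * flowTau ω r)) r := by
  have h := ((Real.hasDerivAt_cosh (r * ‖ω‖)).comp r ((hasDerivAt_id r).mul_const ‖ω‖)).ofReal_comp
  refine h.congr_deriv ?_
  rw [conj_mul_flowTau, flowNu, ← Complex.ofReal_mul, Real.tanh_eq_sinh_div_cosh]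
  have := (Real.cosh_pos (r * ‖ω‖)).ne'
  congr 1
  field_simp

lemma flowNu_zpow_neg_two (ω : ℂ) (r : ℝ) :
    flowNu ω r ^ (-2 : ℤ) = 1 - flowTau ω r * conj (flowTau ω r) := by
  rw [Complex.mul_conj, Complex.normSq_eq_norm_sq, flowNu, flowTau, norm_mul, norm_div,
    Complex.norm_real, Complex.norm_real, norm_norm, mul_pow, Real.norm_eq_abs, sq_abs]
  rcases eq_or_ne ω 0 with rfl | h
  · simp
  · rw [div_self (by simpa using h), one_pow, one_mul, Real.tanh_eq_sinh_div_cosh, zpow_neg]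
    have h0 := (Real.cosh_pos (r * ‖ω‖)).ne'
    have h1 := Real.cosh_sq (r * ‖ω‖)
    norm_cast
    field_simp
    linarith

/-! ### The explicit matrix element: evolution, growth and initial value -/

/-- The explicit matrix element `⟨s t| exp(r(ω* a_R a_I - ω a_R† a_I†)) |k m⟩`. -/
noncomputable def squeezeElement (ω : ℂ) (s t k m : ℕ) (r : ℝ) : ℂ :=
  if (m : ℤ) - k = t - s then
    (√((s.factorial : ℝ) * t.factorial * k.factorial * m.factorial) : ℝ) *
      squeezeSum (flowTau ω r) (conj (flowTau ω r)) (flowNu ω r) s k (t - s)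
  else 0

lemma squeezeSum_eq_zero (τ σ ν : ℂ) (s : ℕ) {k d : ℤ} (h : k < 0 ∨ k + d < 0) :
    squeezeSum τ σ ν s k d = 0 := by
  refine Finset.sum_eq_zero fun l _ => ?_
  rw [squeezeTerm]
  by_cases hl : k - l < 0
  · rw [zdivPow_of_neg σ hl]; ring
  · rw [zdivPow_of_neg 1 (n := l + d) (by omega)]; ring

lemma sqrt_factorial_succ (s t k m : ℕ) :
    √((s.factorial : ℝ) * t.factorial * (k + 1).factorial * (m + 1).factorial) =
      √((k : ℝ) + 1) * √((m : ℝ) + 1) *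
        √((s.factorial : ℝ) * t.factorial * k.factorial * m.factorial) := by
  rw [← Real.sqrt_mul (by positivity), ← Real.sqrt_mul (by positivity), Nat.factorial_succ,
    Nat.factorial_succ]
  congr 1
  push_cast
  ring

lemma isSqueezeEvolution_squeezeElement (ω : ℂ) (s t : ℕ) :
    IsSqueezeEvolution ω fun k m r => squeezeElement ω s t k m r := by
  intro k m r
  by_cases hd : (m : ℤ) - k = t - s
  · have hup : ((m + 1 : ℕ) : ℤ) - (k + 1 : ℕ) = t - s := by push_cast; omega
    simp only [squeezeElement, if_pos hd, if_pos hup]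
    have h := (hasDerivAt_squeezeSum (hasDerivAt_flowTau ω r) (hasDerivAt_conj_flowTau ω r)
      (hasDerivAt_flowNu ω r) (flowNu_ne_zero ω r) (flowNu_zpow_neg_two ω r)
      (mul_conj_flowTau ω r) s k (t - s)).const_mul
      ((√((s.factorial : ℝ) * t.factorial * k.factorial * m.factorial) : ℝ) : ℂ)
    refine h.congr_deriv ?_
    have hraise : ((√((s.factorial : ℝ) * t.factorial * k.factorial * m.factorial) : ℝ) : ℂ) *
        ((k + 1) * (m + 1)) = (√((k : ℝ) + 1) * √((m : ℝ) + 1) : ℝ) *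
          (√((s.factorial : ℝ) * t.factorial * (k + 1).factorial * (m + 1).factorial) : ℝ) := by
      rw [sqrt_factorial_succ]
      have hk := Real.mul_self_sqrt (show (0 : ℝ) ≤ k + 1 by positivity)
      have hm := Real.mul_self_sqrt (show (0 : ℝ) ≤ m + 1 by positivity)
      have : ((k + 1) * (m + 1) : ℂ) = (((k : ℝ) + 1) * ((m : ℝ) + 1) : ℝ) := by push_cast; rfl
      rw [this, ← Complex.ofReal_mul, ← Complex.ofReal_mul]
      congr 1
      nth_rewrite 1 [← hk, ← hm]
      ring
    have hm : (m : ℂ) + 1 = k + 1 + ((t - s : ℤ) : ℂ) := by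
      rw [← hd]; push_cast; ring
    have hlower : ((√((s.factorial : ℝ) * t.factorial * k.factorial * m.factorial) : ℝ) : ℂ) *
        squeezeSum (flowTau ω r) (conj (flowTau ω r)) (flowNu ω r) s (k - 1) (t - s) =
        (√(k : ℝ) * √(m : ℝ) : ℝ) * squeezeElement ω s t (k - 1) (m - 1) r := by
      -- At `k = 0` or `m = 0` the truncated subtraction is harmless: the square root kills the
      -- right side, and the sum with a negative photon number kills the left.
      rcases k with _ | k
      · rw [squeezeSum_eq_zero _ _ _ _ (by left; simp)]; simp
      rcases m with _ | m
      · rw [squeezeSum_eq_zero _ _ _ _ (by right; rw [← hd]; simp)]; simp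
      have hdown : (m : ℤ) - k = t - s := by push_cast at hd; omega
      simp only [squeezeElement, add_tsub_cancel_right, if_pos hdown]
      rw [sqrt_factorial_succ, show ((k + 1 : ℕ) : ℤ) - 1 = k by push_cast; ring]
      push_cast
      ring
    have hk : ((k + 1 : ℕ) : ℤ) = (k : ℤ) + 1 := by push_cast; rfl
    rw [hk, mul_sub]
    simp only [squeezeElement] at hlower
    rw [hm] at hraise
    push_cast at hraise hlower ⊢
    linear_combination conj ω * hlower - ω * squeezeSum (flowTau ω r) (conj (flowTau ω r)) (flowNu ω r) s (k + 1) (t - s) * hraise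
  · have hup : ¬ ((m + 1 : ℕ) : ℤ) - (k + 1 : ℕ) = t - s := by push_cast; omega
    have hlower : ((√(k : ℝ) * √(m : ℝ) : ℝ) : ℂ) * squeezeElement ω s t (k - 1) (m - 1) r = 0 := by
      rcases k with _ | k
      · simp
      rcases m with _ | m
      · simp
      rw [squeezeElement, if_neg, mul_zero]
      push_cast at hd ⊢
      simpa using hd
    rw [mul_assoc (conj ω), hlower]
    simp only [squeezeElement, if_neg hd, if_neg hup, mul_zero, sub_zero]
    exact hasDerivAt_const r 0

lemma sqrt_factorial_mul_le (k m : ℕ) :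
    √((k.factorial : ℝ) * m.factorial) ≤ (max k m).factorial := by
  rw [Real.sqrt_le_left (by positivity), sq]
  have h1 : k.factorial ≤ (max k m).factorial := Nat.factorial_le (le_max_left _ _)
  have h2 : m.factorial ≤ (max k m).factorial := Nat.factorial_le (le_max_right _ _)
  exact_mod_cast Nat.mul_le_mul h1 h2

/-- The growth of `√(k! m!)` is offset by the factor `1 / (k - l)!` from the lowering part: `max k m
- (k - l) ≤ s + t`, so only `(s + t)!` and a binomial coefficient at most `2 ^ N` remain. This is
the exponential growth allowed in `IsSqueezeEvolution.eq_zero`. -/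
lemma norm_squeezeElement_le (ω : ℂ) (s t : ℕ) (N k m : ℕ) (r : ℝ) (hk : k ≤ N) (hm : m ≤ N) :
    ‖squeezeElement ω s t k m r‖ ≤
      √((s.factorial : ℝ) * t.factorial) * ((s + 1) * (s + t).factorial) * 2 ^ N := by
  unfold squeezeElement
  split_ifs with hd
  swap
  · rw [norm_zero]; positivity
  have hτ := norm_flowTau_le_one ω r
  have hterm (l : ℕ) (hl : l ≤ s) : √((k.factorial : ℝ) * m.factorial) *
      ‖squeezeTerm (flowTau ω r) (conj (flowTau ω r)) (flowNu ω r) s k (t - s) l‖ ≤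
      (s + t).factorial * 2 ^ N := by
    by_cases hneg : k < l ∨ (l : ℤ) + (t - s) < 0
    · have : squeezeTerm (flowTau ω r) (conj (flowTau ω r)) (flowNu ω r) s k (t - s) l = 0 := by
        rw [squeezeTerm]
        rcases hneg with h | h
        · rw [zdivPow_of_neg _ (n := (k : ℤ) - l) (by omega)]; ring
        · rw [zdivPow_of_neg 1 h]; ring
      rw [this, norm_zero, mul_zero]
      positivity
    push Not at hneg
    obtain ⟨hlk, hld⟩ := hneg
    have h1 : ‖zdivPow (-flowTau ω r) (s - l)‖ ≤ 1 := norm_zdivPow_le_one (by rwa [norm_neg]) _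
    have h2 : ‖zdivPow (conj (flowTau ω r)) (k - l)‖ ≤ 1 / (k - l).factorial := by
      rw [show (k : ℤ) - l = (k - l : ℕ) by omega, zdivPow_natCast, norm_div, norm_pow,
        RCLike.norm_conj, Complex.norm_natCast]
      gcongr
      exact pow_le_one₀ (norm_nonneg _) hτ
    have h3 : ‖flowNu ω r ^ (-(2 * (l : ℤ) + (t - s) + 1))‖ ≤ 1 := by
      have hexp : 2 * (l : ℤ) + (t - s) + 1 = ((2 * (l : ℤ) + (t - s) + 1).toNat : ℤ) := by omega
      rw [hexp, zpow_neg, zpow_natCast, norm_inv, norm_pow, flowNu, Complex.norm_real,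
        Real.norm_of_nonneg (Real.cosh_pos _).le]
      exact inv_le_one_of_one_le₀ (one_le_pow₀ (Real.one_le_cosh _))
    have h4 (n : ℤ) : ‖zdivPow 1 n‖ ≤ 1 := norm_zdivPow_le_one (by simp) n
    have hT : ‖squeezeTerm (flowTau ω r) (conj (flowTau ω r)) (flowNu ω r) s k (t - s) l‖ ≤
        1 * (1 / (k - l).factorial) * 1 * (1 * 1) := by
      rw [squeezeTerm]
      simp only [norm_mul]
      gcongr
      · exact h4 _
      · exact h4 _
    have hfac : (max k m).factorial ≤ (s + t).factorial * 2 ^ N * (k - l).factorial := by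
      have hle : k - l ≤ max k m := (Nat.sub_le _ _).trans (le_max_left _ _)
      rw [← Nat.choose_mul_factorial_mul_factorial hle]
      have e1 : (max k m).choose (k - l) ≤ 2 ^ N :=
        (Nat.choose_le_two_pow _ _).trans (Nat.pow_le_pow_right (by norm_num) (max_le hk hm))
      have e2 : (max k m - (k - l)).factorial ≤ (s + t).factorial :=
        Nat.factorial_le (by omega)
      calc _ ≤ 2 ^ N * (k - l).factorial * (s + t).factorial := by gcongr
        _ = _ := by ring
    calc _ ≤ ((max k m).factorial : ℝ) * (1 * (1 / (k - l).factorial) * 1 * (1 * 1)) := by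
          gcongr
          exact sqrt_factorial_mul_le k m
      _ = (max k m).factorial / (k - l).factorial := by ring
      _ ≤ _ := by
          rw [div_le_iff₀ (by positivity)]
          exact_mod_cast hfac
  rw [norm_mul, Complex.norm_real, Real.norm_of_nonneg (Real.sqrt_nonneg _),
    mul_assoc ((s.factorial : ℝ) * t.factorial), Real.sqrt_mul (by positivity), mul_assoc, mul_assoc (√_)]
  refine mul_le_mul_of_nonneg_left ?_ (Real.sqrt_nonneg _)
  calc _ ≤ √((k.factorial : ℝ) * m.factorial) * ∑ l ∈ Finset.range (s + 1),
        ‖squeezeTerm (flowTau ω r) (conj (flowTau ω r)) (flowNu ω r) s k (t - s) l‖ := by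
        gcongr
        exact norm_sum_le _ _
    _ ≤ ∑ l ∈ Finset.range (s + 1), ((s + t).factorial : ℝ) * 2 ^ N := by
        rw [Finset.mul_sum]
        exact Finset.sum_le_sum fun l hl => hterm l (Nat.lt_succ_iff.1 (Finset.mem_range.1 hl))
    _ = _ := by simp; ring

lemma squeezeElement_zero (ω : ℂ) (s t k m : ℕ) :
    squeezeElement ω s t k m 0 = if (s, t) = (k, m) then 1 else 0 := by
  have hτ : flowTau ω 0 = 0 := by simp [flowTau]
  have hν : flowNu ω 0 = 1 := by simp [flowNu]
  have hpow {n : ℤ} (hn : n ≠ 0) : zdivPow 0 n = 0 := by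
    rcases lt_or_gt_of_ne hn with h | h
    · exact zdivPow_of_neg _ h
    · rw [show n = (n.toNat : ℤ) by omega, zdivPow_natCast, zero_pow (by omega), zero_div]
  -- At `r = 0` a divided power of `0` survives only with exponent `0`, which forces `l = s` and `l
  -- = k`.
  rw [squeezeElement, hτ, hν, map_zero, squeezeSum, Finset.sum_eq_single s]
  · by_cases hsk : s = k
    · subst hsk
      by_cases hd : (m : ℤ) - s = t - s
      · obtain rfl : m = t := by omega
        have hs : (s.factorial : ℂ) ≠ 0 := by exact_mod_cast s.factorial_ne_zero
        have hm : (m.factorial : ℂ) ≠ 0 := by exact_mod_cast m.factorial_ne_zero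
        rw [if_pos hd, if_pos rfl, squeezeTerm, sub_self, neg_zero, one_zpow,
          show (s : ℤ) + (m - s) = m by ring, show (0 : ℤ) = ((0 : ℕ) : ℤ) by rfl,
          zdivPow_natCast, zdivPow_natCast, zdivPow_natCast, mul_assoc ((s.factorial : ℝ) * _),
          Real.sqrt_mul_self (by positivity)]
        push_cast
        simp
        field_simp
      · rw [if_neg hd, if_neg]
        simp only [Prod.mk.injEq, true_and]
        omega
    · rw [squeezeTerm, hpow (n := (k : ℤ) - s) (by omega)]
      simp [hsk]
  · intro l _ hl
    rw [squeezeTerm, neg_zero, hpow (n := (s : ℤ) - l) (by omega)]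
    ring
  · simp

/-! ### Passage to the stated sum and conclusion -/

lemma zpow_mul_neg_norm_sq_pow (τ : ℂ) {s k u : ℕ} (hu : k ≤ s + u) :
    (-τ) ^ ((s : ℤ) - k) * (-((‖τ‖ : ℝ) : ℂ) ^ 2) ^ u = (-τ) ^ (s + u - k) * conj τ ^ u := by
  -- For `τ = 0` the integer exponent may be negative only if `u > 0`, and then both sides vanish.
  rcases eq_or_ne τ 0 with rfl | hτ
  · rcases Nat.eq_zero_or_pos u with rfl | hu0
    · rw [pow_zero, pow_zero, show (s : ℤ) - k = (s + 0 - k : ℕ) by omega, zpow_natCast]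
    · simp [hu0.ne']
  · have h : -((‖τ‖ : ℝ) : ℂ) ^ 2 = -τ * conj τ := by
      rw [neg_mul, Complex.mul_conj']
    rw [h, mul_pow, ← mul_assoc, ← zpow_natCast (-τ) u, ← zpow_add₀ (neg_ne_zero.2 hτ),
      show (s : ℤ) - k + u = (s + u - k : ℕ) by omega, zpow_natCast]

/-- The substitution is `l = k - u`, where `u` counts the photon pairs removed by the lowering
factor. Values of `l` not reached have `l > k` or `l + t - s < 0`, and contribute zero. -/
lemma squeezeSum_eq_sum_Icc (τ ν : ℂ) {s t k m : ℕ} (hd : (m : ℤ) - k = t - s) :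
    squeezeSum τ (conj τ) ν s k (t - s) = (-τ) ^ ((s : ℤ) - k) *
      ∑ u ∈ Finset.Icc (k - s) (min k m), (-((‖τ‖ : ℝ) : ℂ) ^ 2) ^ u *
        ν ^ (-(k : ℤ) - (m : ℤ) + 2 * (u : ℤ) - 1) /
          (((s + u - k).factorial : ℂ) * (u.factorial : ℂ) * ((k - u).factorial : ℂ) *
            ((m - u).factorial : ℂ)) := by
  rw [Finset.mul_sum, squeezeSum]
  symm
  refine Finset.sum_of_injOn (fun u => k - u) ?_ ?_ ?_ ?_
  · intro u hu v hv huv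
    simp only [Finset.coe_Icc, Set.mem_Icc, le_inf_iff] at hu hv huv
    omega
  · intro u hu
    simp only [Finset.coe_Icc, Set.mem_Icc, le_inf_iff, Finset.coe_range, Set.mem_Iio] at hu ⊢
    omega
  · intro l hl hl'
    rw [squeezeTerm]
    by_cases hlk : (k : ℤ) - l < 0
    · rw [zdivPow_of_neg _ hlk]; ring
    by_cases hld : (l : ℤ) + (t - s) < 0
    · rw [zdivPow_of_neg 1 hld]; ring
    refine absurd ⟨k - l, ?_, ?_⟩ hl'
    · simp only [Finset.mem_range] at hl
      simp only [Finset.coe_Icc, Set.mem_Icc, le_inf_iff]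
      omega
    · change k - (k - l) = l
      omega
  · intro u hu
    simp only [Finset.mem_Icc, le_inf_iff] at hu
    obtain ⟨h1, h2, h3⟩ := hu
    rw [squeezeTerm, show (s : ℤ) - (k - u : ℕ) = (s + u - k : ℕ) by omega,
      show (k : ℤ) - (k - u : ℕ) = (u : ℕ) by omega,
      show ((k - u : ℕ) : ℤ) + (t - s) = (m - u : ℕ) by omega,
      show -(2 * ((k - u : ℕ) : ℤ) + (t - s) + 1) = -(k : ℤ) - m + 2 * u - 1 by omega,
      zdivPow_natCast, zdivPow_natCast, zdivPow_natCast, zdivPow_natCast, one_pow, one_pow,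
      mul_div_assoc', ← mul_assoc, zpow_mul_neg_norm_sq_pow τ (by omega)]
    have f1 : ((s + u - k).factorial : ℂ) ≠ 0 := by exact_mod_cast Nat.factorial_ne_zero _
    have f2 : (u.factorial : ℂ) ≠ 0 := by exact_mod_cast Nat.factorial_ne_zero _
    have f3 : ((k - u).factorial : ℂ) ≠ 0 := by exact_mod_cast Nat.factorial_ne_zero _
    have f4 : ((m - u).factorial : ℂ) ≠ 0 := by exact_mod_cast Nat.factorial_ne_zero _
    field_simp

section

variable {H : Type*} [NormedAddCommGroup H] [InnerProductSpace ℂ H]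

lemma IsTwoModeSqueezer.inner_eq_squeezeElement {b : HilbertBasis (ℕ × ℕ) ℂ H} {ω : ℂ}
    {S : H ≃ₗᵢ[ℂ] H} (hS : IsTwoModeSqueezer b ω S) (s t k m : ℕ) :
    inner ℂ (b (s, t)) (S (b (k, m))) = squeezeElement ω s t k m 1 := by
  obtain ⟨U, hU, hderiv, rfl⟩ := hS
  have hev := (hU.isSqueezeEvolution b ω hderiv (b (s, t))).sub
    (isSqueezeEvolution_squeezeElement ω s t)
  set M := √((s.factorial : ℝ) * t.factorial) * ((s + 1) * (s + t).factorial)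
  have hM : 0 ≤ M := by positivity
  -- In the constant `1 + M`, the `1` bounds the unitary matrix element by Cauchy–Schwarz and `M`
  -- belongs to the explicit one.
  refine sub_eq_zero.1 (hev.eq_zero (M := 1 + M) (K := 2) (by positivity) one_le_two ?_ ?_ k m
    zero_le_one)
  · intro N k m r hk hm
    refine (norm_sub_le _ _).trans ?_
    have h1 : ‖inner ℂ (b (s, t)) (U r (b (k, m)))‖ ≤ 1 := by
      refine (norm_inner_le_norm _ _).trans_eq ?_
      rw [LinearIsometryEquiv.norm_map, b.orthonormal.1, b.orthonormal.1, one_mul]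
    have h2 := norm_squeezeElement_le ω s t N k m r hk hm
    have h3 : (1 : ℝ) ≤ 2 ^ N := one_le_pow₀ one_le_two
    rw [add_mul, one_mul]
    linarith
  · intro k m
    rw [hU.apply_zero, FiniteFock.inner_basis, squeezeElement_zero, sub_self]

lemma IsTwoModeSqueezer.unique {b : HilbertBasis (ℕ × ℕ) ℂ H} {ω : ℂ} {S S' : H ≃ₗᵢ[ℂ] H}
    (hS : IsTwoModeSqueezer b ω S) (hS' : IsTwoModeSqueezer b ω S') : S = S' := by
  have hb (p : ℕ × ℕ) : S (b p) = S' (b p) := by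
    refine b.repr.injective (lp.ext (funext fun q => ?_))
    rw [b.repr_apply_apply, b.repr_apply_apply, hS.inner_eq_squeezeElement,
      hS'.inner_eq_squeezeElement]
  have hψ (ψ : FiniteFock) : S (FiniteFock.toHilbert b ψ) = S' (FiniteFock.toHilbert b ψ) := by
    induction ψ using Finsupp.induction_linear with
    | zero => simp
    | add f g hf hg => simp only [map_add, hf, hg]
    | single p c => simp [hb]
  exact LinearIsometryEquiv.ext fun x => congrFun
    ((FiniteFock.denseRange_toHilbert b).equalizer S.continuous S'.continuous (funext hψ)) x

end

theorem mainTheorem3 {H : Type*} [NormedAddCommGroup H] [InnerProductSpace ℂ H] [CompleteSpace H]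
    (b : HilbertBasis (ℕ × ℕ) ℂ H) (ω : ℂ) :
    (∃! S : H ≃ₗᵢ[ℂ] H, IsTwoModeSqueezer b ω S) ∧
    ∀ S : H ≃ₗᵢ[ℂ] H, IsTwoModeSqueezer b ω S → ∀ s t k m : ℕ,
      inner ℂ (b (s, t)) (S (b (k, m))) =
        (-squeezeTau ω) ^ ((s : ℤ) - (k : ℤ)) *
          ((Real.sqrt ((s.factorial : ℝ) * (t.factorial : ℝ) * (k.factorial : ℝ) * (m.factorial : ℝ)) : ℝ) : ℂ) *
          (if (s : ℤ) - (k : ℤ) = (t : ℤ) - (m : ℤ) then 1 else 0) *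
          -- the natural-number difference `k - s` is `max (k - s) 0`
          ∑ u ∈ Finset.Icc (k - s) (min k m),
            (-((‖squeezeTau ω‖ : ℝ) : ℂ) ^ 2) ^ u *
                ((squeezeNu ω : ℝ) : ℂ) ^ (-(k : ℤ) - (m : ℤ) + 2 * (u : ℤ) - 1) /
              (((s + u - k).factorial : ℂ) * (u.factorial : ℂ) * ((k - u).factorial : ℂ) * ((m - u).factorial : ℂ)) := by
  constructor
  · obtain ⟨S, hS⟩ := exists_isTwoModeSqueezer b ω
    exact ⟨S, hS, fun S' hS' => hS'.unique hS⟩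
  intro S hS s t k m
  rw [hS.inner_eq_squeezeElement, squeezeElement]
  by_cases hd : (m : ℤ) - k = t - s
  · rw [if_pos hd, if_pos (by omega), flowTau_one, flowNu_one, squeezeSum_eq_sum_Icc _ _ hd]
    ring
  · rw [if_neg hd, if_neg (by omega)]
    ring
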